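/- Let $\alpha \neq 0$ be a real constant. Substituting $u = \varphi^{\alpha}$ in the Korteweg–de Vries equation $u_t + u_{xxx} - 6 u u_x = 0$ and multiplying by $\varphi^{3-\alpha}$ gives $$\alpha \varphi^2 \varphi_{xxx} + 3\alpha(\alpha-1)\varphi\,\varphi_x \varphi_{xx} + \alpha(\alpha-1)(\alpha-2)\varphi_x^3 + \alpha \varphi^2 \varphi_t - 6\alpha\, \varphi^{\alpha+2} \varphi_x = 0. \qquad (*)$$ A function $\varphi(x,t)$ may take complex values. The powers of $\varphi = u^{1/\alpha}$ are taken with the branch for which $\varphi^\alpha = u$: for an arbitrary integer $k$ and $u\neq 0$ real, put $\ell = \frac{1}{\alpha}(\operatorname{Log} u + 2\pi i k)$ with the principal logarithm $\operatorname{Log}$, $u^{1/\alpha} = e^{\ell}$ and $\varphi^{\alpha+2} = e^{(\alpha+2)\ell}$. Then, for every $k$, the following functions are smooth solutions of $(*)$. 1. For every $c>0$, on all of $\mathbb{R}^2$, $$\varphi(x,t) = \Big\{ -\frac{c}{2}\operatorname{sech}^2\Big[\frac{\sqrt c}{2}(x-ct)\Big]\Big\}^{1/\alpha}.$$ 2.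 For every $N$, all real $\xi_1 \ge \xi_2 \ge \dots \ge \xi_N > 0$ and all nonzero real $\beta_1,\dots,\beta_N$, $$\varphi(x,t) = \Big\{ -2 \frac{\partial^2}{\partial x^2} \ln \det A(x,t) \Big\}^{1/\alpha}, \qquad A_{nm}(x,t) = \delta_{nm} + \frac{\beta_n e^{8\xi_n^3 t} e^{-(\xi_n+\xi_m)x}}{\xi_n+\xi_m},$$ on the open set of all $(x,t)$ at which $\det A \ne 0$ and $\partial_x^2 \ln\det A \neq 0$ (where $\det A<0$, $\ln \det A$ is read as $\ln|\det A|$, which has the same $x$-derivatives). 3. On all of $\mathbb{R}^2$, $$\varphi(x,t) = \Big\{ -12\, \frac{3 + 4\cosh(8t-2x) + \cosh(64t-4x)}{[\cosh(36t-3x) + 3\cosh(28t-x)]^2}\Big\}^{1/\alpha}.$$ -/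

import Mathlib

open scoped ContDiff

noncomputable section

namespace KdVPower

/-- `φ : ℝ → ℝ → ℂ`, `(x, t) ↦ φ x t`, is a smooth, nowhere vanishing solution on the open set `Ω` of
`α φ² φ_xxx + 3α(α-1) φ φ_x φ_xx + α(α-1)(α-2) φ_x³ + α φ² φ_t - 6α φ^(α+2) φ_x = 0`,
the powers of `φ` being taken with respect to the continuous logarithm `L` of `φ` on `Ω`,
that is, `φ^s = exp (s L)`. -/
structure IsSolutionOn (α : ℝ) (Ω : Set (ℝ × ℝ)) (φ L : ℝ → ℝ → ℂ) : Prop where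
  isOpen : IsOpen Ω
  smooth : ContDiffOn ℝ ∞ (fun p : ℝ × ℝ => φ p.1 p.2) Ω
  continuousOn_log : ContinuousOn (fun p : ℝ × ℝ => L p.1 p.2) Ω
  exp_log : ∀ x t : ℝ, (x, t) ∈ Ω → Complex.exp (L x t) = φ x t
  equation : ∀ x t : ℝ, (x, t) ∈ Ω →
    (α : ℂ) * φ x t ^ 2 * iteratedDeriv 3 (fun y => φ y t) x
      + 3 * (α : ℂ) * ((α : ℂ) - 1) * φ x t * deriv (fun y => φ y t) x
          * iteratedDeriv 2 (fun y => φ y t) x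
      + (α : ℂ) * ((α : ℂ) - 1) * ((α : ℂ) - 2) * deriv (fun y => φ y t) x ^ 3
      + (α : ℂ) * φ x t ^ 2 * deriv (fun s => φ x s) t
      - 6 * (α : ℂ) * Complex.exp (((α : ℂ) + 2) * L x t) * deriv (fun y => φ y t) x = 0

/-- The `k`-th branch of `u^(1/α)`; for `k = 0` it is the principal branch. -/
def root (α : ℝ) (k : ℤ) (u : ℝ → ℝ → ℝ) (x t : ℝ) : ℂ :=
  (u x t : ℂ) ^ (1 / (α : ℂ)) * Complex.exp (2 * Real.pi * k * Complex.I / α)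

/-- The logarithm of the `k`-th branch of `u^(1/α)` with which the substitution is inverted:
`exp (α * logRoot α k u x t) = u x t` wherever `u x t ≠ 0` (and `α ≠ 0`). -/
def logRoot (α : ℝ) (k : ℤ) (u : ℝ → ℝ → ℝ) (x t : ℝ) : ℂ :=
  (Complex.log (u x t : ℂ) + 2 * Real.pi * k * Complex.I) / α

/-- The soliton of velocity `c` of the Korteweg–de Vries equation `u_t + u_xxx - 6 u u_x = 0`. -/
def soliton (c : ℝ) (x t : ℝ) : ℝ :=
  -(c / 2) * (1 / Real.cosh (Real.sqrt c / 2 * (x - c * t))) ^ 2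

/-- The matrix `A(x,t)` of the `N`-soliton solution. -/
def solitonMatrix {N : ℕ} (ξ β : Fin N → ℝ) (x t : ℝ) : Matrix (Fin N) (Fin N) ℝ :=
  Matrix.of fun n m => (if n = m then 1 else 0) +
    β n * Real.exp (8 * ξ n ^ 3 * t) * Real.exp (-(ξ n + ξ m) * x) / (ξ n + ξ m)

/-- `-2 ∂²/∂x² ln det A(x,t)`. As `Real.log` is `ln |·|`, this is meaningful for `det A ≠ 0`. -/
def multisoliton {N : ℕ} (ξ β : Fin N → ℝ) (x t : ℝ) : ℝ :=
  -2 * iteratedDeriv 2 (fun y => Real.log (solitonMatrix ξ β y t).det) x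

/-- The points at which `det A` and the `N`-soliton solution do not vanish. -/
def multisolitonDomain {N : ℕ} (ξ β : Fin N → ℝ) : Set (ℝ × ℝ) :=
  {p | (solitonMatrix ξ β p.1 p.2).det ≠ 0 ∧ multisoliton ξ β p.1 p.2 ≠ 0}

/-- The bisoliton with initial value `-6 sech² x`. -/
def bisoliton (x t : ℝ) : ℝ :=
  -12 * ((3 + 4 * Real.cosh (8 * t - 2 * x) + Real.cosh (64 * t - 4 * x)) /
    (Real.cosh (36 * t - 3 * x) + 3 * Real.cosh (28 * t - x)) ^ 2)

end KdVPower

end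

/-! The nonlinear equation is the KdV equation multiplied by `φ³ / u`, where `u = φ^α`. Since `u` is
real and nonvanishing, a branch of its logarithm differs locally from `ln |u|` by a constant, so the
negative axis causes no trouble. It remains to solve KdV; the reduction is `IsSolutionOn.of_kdv`.

For KdV, invertible diagonal factors turn `A` into a symmetric matrix `S`: a diagonal of
exponentials plus the Cauchy matrix `1 / (ξ n + ξ m)`. They contribute to `ln |det A|` only a
function affine in `x`. With `D = diag ξ`, the anticommutators of the Cauchy matrix with `D` and
`D³` and its commutator with `D²` have rank at most 1, 3 and 2. Hence the moments `W i j` of `S⁻¹`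
against powers of `ξ` satisfy closed quadratic rules: `hasDerivAt_moment_left`,
`hasDerivAt_moment_right` and the algebraic relation `moment_add_two`. Since `u = 2 (W₀₀² - 2 W₀₁)`,
KdV becomes a polynomial identity in the moments modulo that relation.

The soliton and the bisoliton are the cases `N = 1, 2` with suitable `ξ` and `β`; there `det A` and
`u` vanish nowhere. -/

namespace KdVPower

/-! ### Derivatives of determinants and inverse matrices -/

section MatrixCalculus

variable {n : Type*} [Fintype n] [DecidableEq n]

/-- Jacobi's formula. -/
theorem hasDerivAt_det {M : ℝ → Matrix n n ℝ} {M' : Matrix n n ℝ} {s : ℝ}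
    (h : ∀ i j, HasDerivAt (fun r => M r i j) (M' i j) s) :
    HasDerivAt (fun r => (M r).det) ((M s).adjugate * M').trace s := by
  have h1 : HasDerivAt (fun r => (M r).det)
      (∑ σ : Equiv.Perm n, ((Equiv.Perm.sign σ : ℤ) : ℝ) *
        ∑ i, (∏ j ∈ Finset.univ.erase i, M s (σ j) j) * M' (σ i) i) s := by
    simp only [Matrix.det_apply']
    refine HasDerivAt.fun_sum fun σ _ => HasDerivAt.const_mul _ ?_
    simpa using HasDerivAt.fun_finsetProd (u := Finset.univ) fun i _ => h (σ i) i
  convert h1 using 1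
  -- Cramer's rule: the diagonal entries of `adj M * M'` are determinants with one column
  -- differentiated.
  have h2 : ∀ i, ((M s).adjugate * M') i i = ((M s).updateCol i (fun k => M' k i)).det := by
    intro i
    rw [← Matrix.cramer_apply, Matrix.cramer_eq_adjugate_mulVec]
    rfl
  simp only [Matrix.trace, Matrix.diag, h2, Matrix.det_apply', Finset.mul_sum]
  rw [Finset.sum_comm]
  refine Finset.sum_congr rfl fun σ _ => Finset.sum_congr rfl fun i _ => ?_
  rw [← Finset.mul_prod_erase _ _ (Finset.mem_univ i), Matrix.updateCol_self, mul_comm (M' _ _)]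
  congr 2
  refine Finset.prod_congr rfl fun j hj => ?_
  rw [Matrix.updateCol_ne (Finset.ne_of_mem_erase hj)]

variable {E : Type*} [NormedAddCommGroup E] [NormedSpace ℝ E]

theorem contDiffAt_det {M : E → Matrix n n ℝ} {p : E} {k : WithTop ℕ∞}
    (h : ∀ i j, ContDiffAt ℝ k (fun q => M q i j) p) :
    ContDiffAt ℝ k (fun q => (M q).det) p := by
  simp only [Matrix.det_apply']
  exact ContDiffAt.sum fun σ _ => contDiffAt_const.mul (contDiffAt_prod fun i _ => h (σ i) i)

theorem contDiffAt_inv_apply {M : E → Matrix n n ℝ} {p : E} {k : WithTop ℕ∞}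
    (h : ∀ i j, ContDiffAt ℝ k (fun q => M q i j) p) (hd : (M p).det ≠ 0) (i j : n) :
    ContDiffAt ℝ k (fun q => (M q)⁻¹ i j) p := by
  simp only [Matrix.inv_def, Ring.inverse_eq_inv', Matrix.smul_apply, Matrix.adjugate_apply,
    smul_eq_mul]
  refine ((contDiffAt_det h).inv hd).mul (contDiffAt_det fun a b => ?_)
  simp only [Matrix.updateRow_apply]
  split_ifs
  · exact contDiffAt_const
  · exact h a b

/-- Cramer's rule gives differentiability of the entries; differentiating `M⁻¹ M = 1`, valid near
`s`, then determines the derivative. Working entrywise avoids choosing a matrix norm. -/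
theorem hasDerivAt_inv_apply {M : ℝ → Matrix n n ℝ} {M' : Matrix n n ℝ} {s : ℝ}
    (h : ∀ i j, ContDiff ℝ 1 (fun r => M r i j))
    (h' : ∀ i j, HasDerivAt (fun r => M r i j) (M' i j) s) (hd : (M s).det ≠ 0) (i j : n) :
    HasDerivAt (fun r => (M r)⁻¹ i j) ((-((M s)⁻¹ * M' * (M s)⁻¹)) i j) s := by
  set K' : Matrix n n ℝ := Matrix.of fun i j => deriv (fun r => (M r)⁻¹ i j) s with hK'
  have hK : ∀ i j, HasDerivAt (fun r => (M r)⁻¹ i j) (K' i j) s := fun i j =>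
    ((contDiffAt_inv_apply (fun a b => (h a b).contDiffAt) hd i j).differentiableAt
      one_ne_zero).hasDerivAt
  have hcont : ContinuousAt (fun r => (M r).det) s :=
    (contDiffAt_det (k := 1) fun a b => (h a b).contDiffAt).continuousAt
  have h0 : K' * M s + (M s)⁻¹ * M' = 0 := by
    ext a b
    have e1 : HasDerivAt (fun r => ((M r)⁻¹ * M r) a b) ((K' * M s + (M s)⁻¹ * M') a b) s := by
      simp only [Matrix.mul_apply, Matrix.add_apply, ← Finset.sum_add_distrib]
      exact HasDerivAt.fun_sum fun c _ => (hK a c).mul (h' c b)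
    have e2 : HasDerivAt (fun r => ((M r)⁻¹ * M r) a b) 0 s := by
      refine (hasDerivAt_const s ((1 : Matrix n n ℝ) a b)).congr_of_eventuallyEq ?_
      filter_upwards [hcont.eventually_ne hd] with r hr
      rw [Matrix.nonsing_inv_mul _ (isUnit_iff_ne_zero.2 hr)]
    exact e1.unique e2
  have h1 : K' = -((M s)⁻¹ * M' * (M s)⁻¹) := by
    have := congrArg (· * (M s)⁻¹) h0
    simp only [add_mul, zero_mul, mul_assoc, Matrix.mul_nonsing_inv _ (isUnit_iff_ne_zero.2 hd),
      mul_one] at this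
    rw [mul_assoc]
    exact eq_neg_of_add_eq_zero_left this
  rw [← h1]
  exact hK i j

end MatrixCalculus

end KdVPower

namespace KdVPower

theorem iteratedDeriv_two_of_hasDerivAt {F : Type*} [NormedAddCommGroup F] [NormedSpace ℝ F]
    {f f₁ : ℝ → F} {x : ℝ} {f₂ : F}
    (h₁ : ∀ᶠ y in nhds x, HasDerivAt f (f₁ y) y) (h₂ : HasDerivAt f₁ f₂ x) :
    iteratedDeriv 2 f x = f₂ := by
  rw [iteratedDeriv_succ, iteratedDeriv_one]
  exact (h₂.congr_of_eventuallyEq (h₁.mono fun y hy => hy.deriv)).deriv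

theorem iteratedDeriv_three_of_hasDerivAt {F : Type*} [NormedAddCommGroup F] [NormedSpace ℝ F]
    {f f₁ f₂ : ℝ → F} {x : ℝ} {f₃ : F}
    (h₁ : ∀ᶠ y in nhds x, HasDerivAt f (f₁ y) y) (h₂ : ∀ᶠ y in nhds x, HasDerivAt f₁ (f₂ y) y)
    (h₃ : HasDerivAt f₂ f₃ x) :
    iteratedDeriv 3 f x = f₃ := by
  rw [iteratedDeriv_succ]
  refine (h₃.congr_of_eventuallyEq ?_).deriv
  filter_upwards [h₁.eventually_nhds, h₂] with y hy₁ hy₂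
  exact iteratedDeriv_two_of_hasDerivAt hy₁ hy₂

/-! ### The substitution `u = φ^α` and its branches -/

section Root

variable {α : ℝ} {k : ℤ} {u : ℝ → ℝ → ℝ}

theorem exp_logRoot {x t : ℝ} (h : u x t ≠ 0) :
    Complex.exp (logRoot α k u x t) = root α k u x t := by
  have : ((u x t : ℝ) : ℂ) ≠ 0 := by exact_mod_cast h
  rw [logRoot, root, Complex.cpow_def_of_ne_zero this, ← Complex.exp_add]
  congr 1
  ring

theorem exp_mul_logRoot (hα : α ≠ 0) {x t : ℝ} (h : u x t ≠ 0) :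
    Complex.exp (α * logRoot α k u x t) = u x t := by
  have h' : ((u x t : ℝ) : ℂ) ≠ 0 := by exact_mod_cast h
  have hα' : (α : ℂ) ≠ 0 := by exact_mod_cast hα
  rw [logRoot, mul_div_cancel₀ _ hα', Complex.exp_add, Complex.exp_log h']
  have : (2 * Real.pi * k * Complex.I : ℂ) = k * (2 * Real.pi * Complex.I) := by ring
  rw [this, Complex.exp_int_mul_two_pi_mul_I, mul_one]

/-- The argument of a nonzero real number is locally constant, even on the branch cut. -/
theorem log_ofReal_eventuallyEq {r : ℝ} (hr : r ≠ 0) :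
    (fun s : ℝ => Complex.log (s : ℂ)) =ᶠ[nhds r]
      fun s => ((Real.log s : ℝ) : ℂ) + Complex.log (r : ℂ) - (Real.log r : ℝ) := by
  rcases hr.lt_or_gt with h | h
  · filter_upwards [eventually_lt_nhds h] with s hs
    apply Complex.ext <;>
      simp [Complex.log_re, Complex.log_im, Complex.arg_ofReal_of_neg hs,
        Complex.arg_ofReal_of_neg h]
  · filter_upwards [eventually_gt_nhds h] with s hs
    rw [← Complex.ofReal_log hs.le, ← Complex.ofReal_log h.le]
    ring

theorem contDiffAt_log_ofReal {r : ℝ} (hr : r ≠ 0) {m : WithTop ℕ∞} :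
    ContDiffAt ℝ m (fun s : ℝ => Complex.log (s : ℂ)) r := by
  refine ContDiffAt.congr_of_eventuallyEq ?_ (log_ofReal_eventuallyEq hr)
  exact ((Complex.ofRealCLM.contDiff.contDiffAt.comp r (Real.contDiffAt_log.2 hr)).add
    contDiffAt_const).sub contDiffAt_const

theorem hasDerivAt_log_ofReal {f : ℝ → ℝ} {f' s : ℝ} (h : HasDerivAt f f' s) (hf : f s ≠ 0) :
    HasDerivAt (fun r => Complex.log (f r : ℂ)) ((f' : ℂ) / (f s : ℂ)) s := by
  have h1 := (h.log hf).ofReal_comp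
  have h2 := ((h1.add_const (Complex.log (f s : ℂ))).sub_const (Real.log (f s) : ℂ))
  push_cast at h2
  exact h2.congr_of_eventuallyEq (h.continuousAt.eventually (log_ofReal_eventuallyEq hf))

theorem hasDerivAt_exp_logRoot {f : ℝ → ℝ} {f' s : ℝ} (h : HasDerivAt f f' s) (hf : f s ≠ 0)
    (c : ℂ) :
    HasDerivAt (fun r => Complex.exp ((Complex.log (f r : ℂ) + c) / α))
      (Complex.exp ((Complex.log (f s : ℂ) + c) / α) * ((f' : ℂ) / (α * f s))) s := by
  have h1 := (((hasDerivAt_log_ofReal h hf).add_const c).div_const (α : ℂ)).cexp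
  convert h1 using 2
  rw [div_div, mul_comm]

/-- The branches of `u^(1/α)` for a smooth, nowhere vanishing real solution `u` of the
Korteweg–de Vries equation, given by its partial derivatives. -/
theorem IsSolutionOn.of_kdv (hα : α ≠ 0) {Ω : Set (ℝ × ℝ)} (hΩ : IsOpen Ω)
    {u₁ u₂ u₃ ut : ℝ → ℝ → ℝ}
    (hu : ContDiffOn ℝ ∞ (fun p : ℝ × ℝ => u p.1 p.2) Ω)
    (hne : ∀ x t, (x, t) ∈ Ω → u x t ≠ 0)
    (h₁ : ∀ x t, (x, t) ∈ Ω → HasDerivAt (fun y => u y t) (u₁ x t) x)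
    (h₂ : ∀ x t, (x, t) ∈ Ω → HasDerivAt (fun y => u₁ y t) (u₂ x t) x)
    (h₃ : ∀ x t, (x, t) ∈ Ω → HasDerivAt (fun y => u₂ y t) (u₃ x t) x)
    (ht : ∀ x t, (x, t) ∈ Ω → HasDerivAt (fun s => u x s) (ut x t) t)
    (kdv : ∀ x t, (x, t) ∈ Ω → ut x t + u₃ x t - 6 * u x t * u₁ x t = 0) :
    IsSolutionOn α Ω (root α k u) (logRoot α k u) := by
  have hlog : ContDiffOn ℝ ∞ (fun p : ℝ × ℝ => logRoot α k u p.1 p.2) Ω := by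
    intro p hp
    have := ((contDiffAt_log_ofReal (m := ∞) (hne p.1 p.2 hp)).comp_contDiffWithinAt p (hu p hp))
    exact (this.add contDiffWithinAt_const).div_const _
  refine ⟨hΩ, ?_, hlog.continuousOn, fun x t h => exp_logRoot (hne x t h), ?_⟩
  · exact hlog.cexp.congr fun p hp => (exp_logRoot (hne p.1 p.2 hp)).symm
  intro x t hxt
  have hα' : (α : ℂ) ≠ 0 := by exact_mod_cast hα
  have hev : ∀ᶠ y in nhds x, (y, t) ∈ Ω :=
    (Continuous.prodMk_left t).continuousAt.eventually (hΩ.mem_nhds hxt)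
  have hevt : ∀ᶠ s in nhds t, (x, s) ∈ Ω :=
    (Continuous.prodMk_right x).continuousAt.eventually (hΩ.mem_nhds hxt)
  -- Put `q = u_x / (α u)`. Then `φ_x = φ q` and `q_x = u_xx / (α u) - α q²`, whence the
  -- coefficients `1 - α` and `1 - 2α` below.
  have d₁ : ∀ y, (y, t) ∈ Ω → HasDerivAt (fun y => root α k u y t)
      (root α k u y t * ((u₁ y t : ℂ) / (α * u y t))) y := by
    intro y hy
    have hevy : ∀ᶠ z in nhds y, (z, t) ∈ Ω :=
      (Continuous.prodMk_left t).continuousAt.eventually (hΩ.mem_nhds hy)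
    rw [← exp_logRoot (hne y t hy)]
    refine (hasDerivAt_exp_logRoot (h₁ y t hy) (hne y t hy) _).congr_of_eventuallyEq ?_
    filter_upwards [hevy] with z hz
    exact (exp_logRoot (hne z t hz)).symm
  have dt : HasDerivAt (fun s => root α k u x s)
      (root α k u x t * ((ut x t : ℂ) / (α * u x t))) t := by
    rw [← exp_logRoot (hne x t hxt)]
    refine (hasDerivAt_exp_logRoot (ht x t hxt) (hne x t hxt) _).congr_of_eventuallyEq ?_
    filter_upwards [hevt] with s hs
    exact (exp_logRoot (hne x s hs)).symm
  have hu0 : ∀ y, (y, t) ∈ Ω → (u y t : ℂ) ≠ 0 := fun y hy => by exact_mod_cast hne y t hy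
  have d₂ : ∀ y, (y, t) ∈ Ω → HasDerivAt (fun y => root α k u y t * ((u₁ y t : ℂ) / (α * u y t)))
      (root α k u y t * ((u₂ y t : ℂ) / (α * u y t)
        + (1 - α) * ((u₁ y t : ℂ) / (α * u y t)) ^ 2)) y := by
    intro y hy
    have := (d₁ y hy).mul ((h₂ y t hy).ofReal_comp.div
      ((h₁ y t hy).ofReal_comp.const_mul (α : ℂ)) (mul_ne_zero hα' (hu0 y hy)))
    refine this.congr_deriv ?_
    have hu0' := hu0 y hy
    simp only [Pi.div_apply]
    field_simp
    ring
  have d₃ : HasDerivAt (fun y => root α k u y t * ((u₂ y t : ℂ) / (α * u y t)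
        + (1 - α) * ((u₁ y t : ℂ) / (α * u y t)) ^ 2))
      (root α k u x t * ((u₃ x t : ℂ) / (α * u x t)
        + 3 * (1 - α) * ((u₁ x t : ℂ) / (α * u x t)) * ((u₂ x t : ℂ) / (α * u x t))
        + (1 - α) * (1 - 2 * α) * ((u₁ x t : ℂ) / (α * u x t)) ^ 3)) x := by
    have e0 := (h₁ x t hxt).ofReal_comp.const_mul (α : ℂ)
    have e1 := (h₂ x t hxt).ofReal_comp.div e0 (mul_ne_zero hα' (hu0 x hxt))
    have e2 := (h₃ x t hxt).ofReal_comp.div e0 (mul_ne_zero hα' (hu0 x hxt))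
    have := (d₁ x hxt).mul (e2.add ((e1.pow 2).const_mul (1 - α : ℂ)))
    refine this.congr_deriv ?_
    have hu0' := hu0 x hxt
    simp only [Pi.div_apply, Pi.add_apply, Pi.pow_apply, Nat.add_one_sub_one, pow_one, Nat.cast_ofNat]
    field_simp
    ring
  rw [iteratedDeriv_three_of_hasDerivAt (hev.mono fun y => d₁ y) (hev.mono fun y => d₂ y) d₃,
    iteratedDeriv_two_of_hasDerivAt (hev.mono fun y => d₁ y) (d₂ x hxt), (d₁ x hxt).deriv,
    dt.deriv]
  -- The chosen branch satisfies `φ^α = u`, so the only non-integer power is `φ^(α+2) = u φ²`.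
  have hexp : Complex.exp (((α : ℂ) + 2) * logRoot α k u x t) = u x t * root α k u x t ^ 2 := by
    rw [add_mul, Complex.exp_add, exp_mul_logRoot hα (hne x t hxt), two_mul, Complex.exp_add,
      exp_logRoot (hne x t hxt), sq]
  rw [hexp]
  have hk : (ut x t : ℂ) + u₃ x t - 6 * u x t * u₁ x t = 0 := by exact_mod_cast kdv x t hxt
  have := hu0 x hxt
  field_simp
  -- The left side is `φ³ / u` times the KdV expression; the rest of the coefficient comes from
  -- clearing denominators.
  linear_combination root α k u x t ^ 3 * (α : ℂ) ^ 2 * (u x t : ℂ) ^ 2 * hk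

end Root

end KdVPower

namespace KdVPower

/-! ### Moments of the inverse of the symmetrised soliton matrix -/

section Multisoliton

variable {N : ℕ} (ξ β : Fin N → ℝ)

/-- The symmetric matrix to which `solitonMatrix` is equivalent up to invertible diagonal
factors. -/
noncomputable def symmMatrix (x t : ℝ) : Matrix (Fin N) (Fin N) ℝ :=
  Matrix.of fun n m => (if n = m then Real.exp (2 * ξ n * x - 8 * ξ n ^ 3 * t) / β n else 0) +
    1 / (ξ n + ξ m)

/-- The vector of the `i`-th powers of the spectral parameters. -/
def powVec (i : ℕ) : Fin N → ℝ := fun n => ξ n ^ i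

/-- The moments of the inverse of `symmMatrix` with respect to powers of `ξ`. -/
noncomputable def moment (i j : ℕ) (x t : ℝ) : ℝ :=
  powVec ξ i ⬝ᵥ ((symmMatrix ξ β x t)⁻¹.mulVec (powVec ξ j))

theorem contDiff_symmMatrix (i j : Fin N) :
    ContDiff ℝ ∞ (fun p : ℝ × ℝ => symmMatrix ξ β p.1 p.2 i j) := by
  simp only [symmMatrix, Matrix.of_apply]
  split_ifs <;> fun_prop

theorem contDiff_symmMatrix_left (t : ℝ) (i j : Fin N) {m : WithTop ℕ∞} :
    ContDiff ℝ m (fun x => symmMatrix ξ β x t i j) := by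
  simp only [symmMatrix, Matrix.of_apply]
  split_ifs <;> fun_prop

theorem contDiff_symmMatrix_right (x : ℝ) (i j : Fin N) {m : WithTop ℕ∞} :
    ContDiff ℝ m (fun t => symmMatrix ξ β x t i j) := by
  simp only [symmMatrix, Matrix.of_apply]
  split_ifs <;> fun_prop

theorem symmMatrix_transpose (x t : ℝ) :
    (symmMatrix ξ β x t).transpose = symmMatrix ξ β x t := by
  ext n m
  simp only [symmMatrix, Matrix.transpose_apply, Matrix.of_apply, add_comm (ξ m)]
  by_cases h : n = m
  · subst h; rfl
  · simp [h, Ne.symm h]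

theorem moment_comm (i j : ℕ) (x t : ℝ) : moment ξ β i j x t = moment ξ β j i x t := by
  rw [moment, moment, Matrix.dotProduct_mulVec, dotProduct_comm, ← Matrix.mulVec_transpose,
    Matrix.transpose_nonsing_inv, symmMatrix_transpose]

variable {ξ β}

theorem contDiffAt_moment {x t : ℝ} (h : (symmMatrix ξ β x t).det ≠ 0) (i j : ℕ) :
    ContDiffAt ℝ ∞ (fun p : ℝ × ℝ => moment ξ β i j p.1 p.2) (x, t) := by
  simp only [moment, dotProduct, Matrix.mulVec]
  exact ContDiffAt.sum fun a _ => contDiffAt_const.mul <| ContDiffAt.sum fun b _ =>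
    (contDiffAt_inv_apply (fun c d => (contDiff_symmMatrix ξ β c d).contDiffAt) h a b).mul
      contDiffAt_const

theorem hasDerivAt_bilin {ι : Type*} [Fintype ι] {K : ℝ → Matrix ι ι ℝ} {K' : Matrix ι ι ℝ} {s : ℝ}
    (h : ∀ i j, HasDerivAt (fun r => K r i j) (K' i j) s) (v w : ι → ℝ) :
    HasDerivAt (fun r => v ⬝ᵥ (K r).mulVec w) (v ⬝ᵥ K'.mulVec w) s := by
  simp only [dotProduct, Matrix.mulVec]
  exact HasDerivAt.fun_sum fun a _ => HasDerivAt.const_mul _ <| HasDerivAt.fun_sum fun b _ =>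
    (h a b).mul_const _

theorem diagonal_mulVec_powVec (a i : ℕ) :
    (Matrix.diagonal (powVec ξ a)).mulVec (powVec ξ i) = powVec ξ (i + a) := by
  ext n
  simp [Matrix.mulVec_diagonal, powVec, pow_add, mul_comm]

theorem powVec_vecMul_diagonal (a i : ℕ) :
    Matrix.vecMul (powVec ξ i) (Matrix.diagonal (powVec ξ a)) = powVec ξ (i + a) := by
  ext n
  simp [Matrix.vecMul_diagonal, powVec, pow_add]

/-- A rank-one middle factor splits the bilinear form; this produces the quadratic terms in the
moment rules. -/
theorem bilin_mul_vecMulVec_mul (K : Matrix (Fin N) (Fin N) ℝ) (i j a b : ℕ) :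
    powVec ξ i ⬝ᵥ (K * Matrix.vecMulVec (powVec ξ a) (powVec ξ b) * K).mulVec (powVec ξ j) =
      (powVec ξ i ⬝ᵥ K.mulVec (powVec ξ a)) * (powVec ξ b ⬝ᵥ K.mulVec (powVec ξ j)) := by
  rw [Matrix.mul_vecMulVec, Matrix.vecMulVec_mul, Matrix.vecMulVec_mulVec,
    ← Matrix.dotProduct_mulVec]
  simp [mul_comm]

theorem bilin_diagonal_mul (K : Matrix (Fin N) (Fin N) ℝ) (i j a : ℕ) :
    powVec ξ i ⬝ᵥ (Matrix.diagonal (powVec ξ a) * K).mulVec (powVec ξ j) =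
      powVec ξ (i + a) ⬝ᵥ K.mulVec (powVec ξ j) := by
  rw [← Matrix.mulVec_mulVec, Matrix.dotProduct_mulVec, powVec_vecMul_diagonal]

theorem bilin_mul_diagonal (K : Matrix (Fin N) (Fin N) ℝ) (i j a : ℕ) :
    powVec ξ i ⬝ᵥ (K * Matrix.diagonal (powVec ξ a)).mulVec (powVec ξ j) =
      powVec ξ i ⬝ᵥ K.mulVec (powVec ξ (j + a)) := by
  rw [← Matrix.mulVec_mulVec, diagonal_mulVec_powVec]

variable (β) in
-- The exponentials scale at rate `2 ξ n`, which is the anticommutator with `D`; the Cauchy part is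
-- constant, and the subtracted all-ones matrix is its anticommutator with `D`.
theorem hasDerivAt_symmMatrix_left (hξ : ∀ i, 0 < ξ i) (x t : ℝ) (n m : Fin N) :
    HasDerivAt (fun y => symmMatrix ξ β y t n m)
      ((Matrix.diagonal (powVec ξ 1) * symmMatrix ξ β x t
        + symmMatrix ξ β x t * Matrix.diagonal (powVec ξ 1)
        - Matrix.vecMulVec (powVec ξ 0) (powVec ξ 0)) n m) x := by
  have hne : ξ n + ξ m ≠ 0 := (add_pos (hξ n) (hξ m)).ne'
  simp only [symmMatrix, Matrix.of_apply, Matrix.sub_apply, Matrix.add_apply,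
    Matrix.diagonal_mul, Matrix.mul_diagonal, Matrix.vecMulVec_apply, powVec, pow_one, pow_zero]
  by_cases h : n = m
  · subst h
    have hl : HasDerivAt (fun y : ℝ => 2 * ξ n * y - 8 * ξ n ^ 3 * t) (2 * ξ n) x := by
      simpa using ((hasDerivAt_id x).const_mul (2 * ξ n)).sub_const (8 * ξ n ^ 3 * t)
    have := ((hl.exp).div_const (β n)).add_const (1 / (ξ n + ξ n))
    simp only [if_true]
    refine this.congr_deriv ?_
    have hn := (hξ n).ne'
    field_simp
    ring
  · simp only [h, if_false]
    refine (hasDerivAt_const x (0 + 1 / (ξ n + ξ m))).congr_deriv ?_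
    field_simp
    ring

variable (β) in
-- As for `x`, with `D³`; the Cauchy correction comes from `a³ + b³ = (a + b)(a² - a b + b²)`.
theorem hasDerivAt_symmMatrix_right (hξ : ∀ i, 0 < ξ i) (x t : ℝ) (n m : Fin N) :
    HasDerivAt (fun s => symmMatrix ξ β x s n m)
      (((-4 : ℝ) • (Matrix.diagonal (powVec ξ 3) * symmMatrix ξ β x t
        + symmMatrix ξ β x t * Matrix.diagonal (powVec ξ 3)
        - (Matrix.vecMulVec (powVec ξ 2) (powVec ξ 0)
          - Matrix.vecMulVec (powVec ξ 1) (powVec ξ 1)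
          + Matrix.vecMulVec (powVec ξ 0) (powVec ξ 2)))) n m) t := by
  have hne : ξ n + ξ m ≠ 0 := (add_pos (hξ n) (hξ m)).ne'
  simp only [symmMatrix, Matrix.of_apply, Matrix.sub_apply, Matrix.add_apply, Matrix.smul_apply,
    Matrix.diagonal_mul, Matrix.mul_diagonal, Matrix.vecMulVec_apply, powVec, pow_one, pow_zero,
    smul_eq_mul]
  by_cases h : n = m
  · subst h
    have hl : HasDerivAt (fun s : ℝ => 2 * ξ n * x - 8 * ξ n ^ 3 * s) (-(8 * ξ n ^ 3)) t := by
      simpa using ((hasDerivAt_id t).const_mul (8 * ξ n ^ 3)).const_sub (2 * ξ n * x)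
    have := ((hl.exp).div_const (β n)).add_const (1 / (ξ n + ξ n))
    simp only [if_true]
    refine this.congr_deriv ?_
    have hn := (hξ n).ne'
    field_simp
    ring
  · simp only [h, if_false]
    refine (hasDerivAt_const t (0 + 1 / (ξ n + ξ m))).congr_deriv ?_
    field_simp
    ring

variable {x t : ℝ}

theorem symmMatrix_inv_sandwich (h : (symmMatrix ξ β x t).det ≠ 0)
    (D Q : Matrix (Fin N) (Fin N) ℝ) :
    (symmMatrix ξ β x t)⁻¹ * (D * symmMatrix ξ β x t + symmMatrix ξ β x t * D - Q)
        * (symmMatrix ξ β x t)⁻¹ =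
      (symmMatrix ξ β x t)⁻¹ * D + D * (symmMatrix ξ β x t)⁻¹
        - (symmMatrix ξ β x t)⁻¹ * Q * (symmMatrix ξ β x t)⁻¹ := by
  have hu := isUnit_iff_ne_zero.2 h
  simp only [mul_sub, mul_add, sub_mul, add_mul, mul_assoc, Matrix.mul_nonsing_inv _ hu, mul_one]
  simp only [← mul_assoc, Matrix.nonsing_inv_mul _ hu, one_mul]

theorem hasDerivAt_moment_left (hξ : ∀ i, 0 < ξ i) (h : (symmMatrix ξ β x t).det ≠ 0) (i j : ℕ) :
    HasDerivAt (fun y => moment ξ β i j y t)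
      (-moment ξ β i (j + 1) x t - moment ξ β (i + 1) j x t
        + moment ξ β i 0 x t * moment ξ β 0 j x t) x := by
  have := hasDerivAt_bilin (hasDerivAt_inv_apply (fun a b => contDiff_symmMatrix_left ξ β t a b)
    (hasDerivAt_symmMatrix_left β hξ x t) h) (powVec ξ i) (powVec ξ j)
  refine this.congr_deriv ?_
  rw [symmMatrix_inv_sandwich h, Matrix.neg_mulVec, Matrix.sub_mulVec, Matrix.add_mulVec,
    dotProduct_neg, dotProduct_sub, dotProduct_add, bilin_mul_vecMulVec_mul, bilin_diagonal_mul,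
    bilin_mul_diagonal]
  simp only [moment]
  ring

theorem hasDerivAt_moment_right (hξ : ∀ i, 0 < ξ i) (h : (symmMatrix ξ β x t).det ≠ 0) (i j : ℕ) :
    HasDerivAt (fun s => moment ξ β i j x s)
      (4 * (moment ξ β i (j + 3) x t + moment ξ β (i + 3) j x t
        - (moment ξ β i 2 x t * moment ξ β 0 j x t - moment ξ β i 1 x t * moment ξ β 1 j x t
          + moment ξ β i 0 x t * moment ξ β 2 j x t))) t := by
  have := hasDerivAt_bilin (hasDerivAt_inv_apply (fun a b => contDiff_symmMatrix_right ξ β x a b)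
    (hasDerivAt_symmMatrix_right β hξ x t) h) (powVec ξ i) (powVec ξ j)
  refine this.congr_deriv ?_
  rw [mul_smul_comm, smul_mul_assoc, symmMatrix_inv_sandwich h, ← neg_smul]
  simp only [mul_add, mul_sub, add_mul, sub_mul, Matrix.smul_mulVec, Matrix.sub_mulVec,
    Matrix.add_mulVec, dotProduct_smul, dotProduct_sub, dotProduct_add, bilin_mul_vecMulVec_mul,
    bilin_diagonal_mul, bilin_mul_diagonal, smul_eq_mul]
  simp only [moment]
  ring

/-- The diagonal part commutes with `D²`, and `(a² - b²) / (a + b) = a - b` makes the Cauchy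
commutator a difference of two rank-one matrices. -/
theorem moment_add_two (hξ : ∀ i, 0 < ξ i) (h : (symmMatrix ξ β x t).det ≠ 0) (i j : ℕ) :
    moment ξ β i (j + 2) x t - moment ξ β (i + 2) j x t =
      moment ξ β i 1 x t * moment ξ β 0 j x t - moment ξ β i 0 x t * moment ξ β 1 j x t := by
  have hu := isUnit_iff_ne_zero.2 h
  set M := symmMatrix ξ β x t with hM
  have h1 : Matrix.diagonal (powVec ξ 2) * M - M * Matrix.diagonal (powVec ξ 2) =
      Matrix.vecMulVec (powVec ξ 1) (powVec ξ 0) - Matrix.vecMulVec (powVec ξ 0) (powVec ξ 1) := by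
    ext n m
    have hne : ξ n + ξ m ≠ 0 := (add_pos (hξ n) (hξ m)).ne'
    simp only [hM, symmMatrix, Matrix.of_apply, Matrix.sub_apply, Matrix.diagonal_mul,
      Matrix.mul_diagonal, Matrix.vecMulVec_apply, powVec, pow_one, pow_zero]
    by_cases hnm : n = m
    · subst hnm
      ring
    · simp only [hnm, if_false]
      field_simp
      ring
  have h2 := congrArg (fun B => M⁻¹ * B * M⁻¹) h1
  simp only [mul_sub, sub_mul] at h2
  have e1 : M⁻¹ * (Matrix.diagonal (powVec ξ 2) * M) * M⁻¹ = M⁻¹ * Matrix.diagonal (powVec ξ 2) := by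
    simp only [mul_assoc, Matrix.mul_nonsing_inv _ hu, mul_one]
  have e2 : M⁻¹ * (M * Matrix.diagonal (powVec ξ 2)) * M⁻¹ = Matrix.diagonal (powVec ξ 2) * M⁻¹ := by
    simp only [← mul_assoc, Matrix.nonsing_inv_mul _ hu, one_mul]
  rw [e1, e2] at h2
  have h3 := congrArg (fun B : Matrix (Fin N) (Fin N) ℝ =>
    powVec ξ i ⬝ᵥ B.mulVec (powVec ξ j)) h2
  simpa only [moment, Matrix.sub_mulVec, dotProduct_sub, bilin_mul_vecMulVec_mul, bilin_diagonal_mul,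
    bilin_mul_diagonal] using h3

variable (ξ) in
theorem det_solitonMatrix (hβ : ∀ i, β i ≠ 0) (x t : ℝ) :
    (solitonMatrix ξ β x t).det =
      (∏ n, β n * Real.exp (8 * ξ n ^ 3 * t - 2 * ξ n * x)) * (symmMatrix ξ β x t).det := by
  have h : solitonMatrix ξ β x t =
      Matrix.diagonal (fun n => β n * Real.exp (8 * ξ n ^ 3 * t - ξ n * x)) * symmMatrix ξ β x t
        * Matrix.diagonal (fun n => Real.exp (-(ξ n * x))) := by
    ext n m
    simp only [solitonMatrix, symmMatrix, Matrix.of_apply, Matrix.diagonal_mul,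
      Matrix.mul_diagonal, mul_add, add_mul]
    congr 1
    · by_cases hnm : n = m
      · subst hnm
        simp only [if_true]
        have := hβ n
        field_simp
        rw [← Real.exp_add, ← Real.exp_add, eq_comm, Real.exp_eq_one_iff]
        ring
      · simp [hnm]
    · rw [mul_assoc (β n), ← Real.exp_add, mul_one_div, div_mul_eq_mul_div, mul_assoc (β n),
        ← Real.exp_add]
      congr 3
      ring
  rw [h, Matrix.det_mul, Matrix.det_mul, Matrix.det_diagonal, Matrix.det_diagonal, mul_right_comm,
    ← Finset.prod_mul_distrib]
  congr 1
  refine Finset.prod_congr rfl fun n _ => ?_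
  rw [mul_assoc, ← Real.exp_add]
  congr 2
  ring

theorem det_symmMatrix_ne_zero (hβ : ∀ i, β i ≠ 0) (h : (solitonMatrix ξ β x t).det ≠ 0) :
    (symmMatrix ξ β x t).det ≠ 0 := by
  rw [det_solitonMatrix ξ hβ] at h
  exact right_ne_zero_of_mul h

/-- Jacobi's formula gives `2 tr D - W₀₀` for `S`; the diagonal prefactors contribute `-2 tr D`. -/
theorem hasDerivAt_log_det_solitonMatrix (hξ : ∀ i, 0 < ξ i) (hβ : ∀ i, β i ≠ 0)
    (h : (solitonMatrix ξ β x t).det ≠ 0) :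
    HasDerivAt (fun y => Real.log (solitonMatrix ξ β y t).det) (-moment ξ β 0 0 x t) x := by
  have hS := det_symmMatrix_ne_zero hβ h
  have hu := isUnit_iff_ne_zero.2 hS
  have hdet := hasDerivAt_det (hasDerivAt_symmMatrix_left β hξ x t)
  have hlin : HasDerivAt (fun y => ∑ n, (Real.log (β n) + (8 * ξ n ^ 3 * t - 2 * ξ n * y)))
      (∑ n, -(2 * ξ n)) x := by
    refine HasDerivAt.fun_sum fun n _ => HasDerivAt.const_add _ ?_
    simpa using ((hasDerivAt_id x).const_mul (2 * ξ n)).const_sub (8 * ξ n ^ 3 * t)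
  have hsum := hlin.add (hdet.log hS)
  have hcont : ContinuousAt (fun y => (symmMatrix ξ β y t).det) x := hdet.continuousAt
  refine (hsum.congr_deriv ?_).congr_of_eventuallyEq ?_
  · have e : (symmMatrix ξ β x t).adjugate =
        (symmMatrix ξ β x t).det • (symmMatrix ξ β x t)⁻¹ := by
      rw [Matrix.inv_def, smul_smul, Ring.mul_inverse_cancel _ hu, one_smul]
    rw [e, smul_mul_assoc, Matrix.trace_smul, smul_eq_mul, mul_div_cancel_left₀ _ hS, mul_sub,
      mul_add, Matrix.trace_sub, Matrix.trace_add, ← mul_assoc, Matrix.trace_mul_comm,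
      ← mul_assoc, ← mul_assoc, Matrix.mul_nonsing_inv _ hu, Matrix.nonsing_inv_mul _ hu, one_mul,
      Matrix.trace_diagonal, Matrix.mul_vecMulVec, Matrix.trace_vecMulVec, dotProduct_comm]
    simp only [moment, powVec, pow_one, Finset.sum_neg_distrib, ← Finset.mul_sum]
    ring
  · filter_upwards [hcont.eventually_ne hS] with y hy
    rw [det_solitonMatrix ξ hβ, Real.log_mul _ hy, Real.log_prod]
    · simp only [Pi.add_apply]
      congr 1
      refine Finset.sum_congr rfl fun n _ => ?_
      rw [Real.log_mul (hβ n) (Real.exp_ne_zero _), Real.log_exp]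
    · exact fun n _ => mul_ne_zero (hβ n) (Real.exp_ne_zero _)
    · exact Finset.prod_ne_zero_iff.2 fun n _ => mul_ne_zero (hβ n) (Real.exp_ne_zero _)

theorem isOpen_det_solitonMatrix_ne_zero (ξ β : Fin N → ℝ) :
    IsOpen {p : ℝ × ℝ | (solitonMatrix ξ β p.1 p.2).det ≠ 0} := by
  refine isOpen_ne_fun ?_ continuous_const
  refine Continuous.matrix_det (continuous_matrix fun i j => ?_)
  simp only [solitonMatrix, Matrix.of_apply]
  fun_prop

theorem eventually_det_ne_zero (h : (solitonMatrix ξ β x t).det ≠ 0) :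
    (∀ᶠ y in nhds x, (solitonMatrix ξ β y t).det ≠ 0) ∧
      ∀ᶠ s in nhds t, (solitonMatrix ξ β x s).det ≠ 0 := by
  have := (isOpen_det_solitonMatrix_ne_zero ξ β).mem_nhds (x := (x, t)) h
  exact ⟨(Continuous.prodMk_left t).continuousAt.eventually this,
    (Continuous.prodMk_right x).continuousAt.eventually this⟩

theorem multisoliton_eq_moment (hξ : ∀ i, 0 < ξ i) (hβ : ∀ i, β i ≠ 0)
    (h : (solitonMatrix ξ β x t).det ≠ 0) :
    multisoliton ξ β x t = 2 * (moment ξ β 0 0 x t ^ 2 - 2 * moment ξ β 0 1 x t) := by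
  rw [multisoliton, iteratedDeriv_two_of_hasDerivAt
    ((eventually_det_ne_zero h).1.mono fun y hy => hasDerivAt_log_det_solitonMatrix hξ hβ hy)
    (hasDerivAt_moment_left hξ (det_symmMatrix_ne_zero hβ h) 0 0).neg, moment_comm ξ β (0 + 1) 0]
  ring_nf

end Multisoliton

end KdVPower

namespace KdVPower

/-! ### The KdV equation for the multisoliton -/

section Multisoliton

variable {N : ℕ} {ξ β : Fin N → ℝ}

/-- Joint smoothness in `(x, t)` is read off from the moment formula, which holds on the open set
`det A ≠ 0`. -/
theorem contDiffAt_multisoliton (hξ : ∀ i, 0 < ξ i) (hβ : ∀ i, β i ≠ 0) {p : ℝ × ℝ}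
    (h : (solitonMatrix ξ β p.1 p.2).det ≠ 0) :
    ContDiffAt ℝ ∞ (fun p : ℝ × ℝ => multisoliton ξ β p.1 p.2) p := by
  have hm := fun i j => contDiffAt_moment (det_symmMatrix_ne_zero hβ h) i j
  refine ((contDiffAt_const (c := (2 : ℝ))).mul (((hm 0 0).pow 2).sub
    ((contDiffAt_const (c := (2 : ℝ))).mul (hm 0 1)))).congr_of_eventuallyEq ?_
  filter_upwards [(isOpen_det_solitonMatrix_ne_zero ξ β).mem_nhds h] with q hq
  exact multisoliton_eq_moment hξ hβ hq

theorem isOpen_multisolitonDomain (hξ : ∀ i, 0 < ξ i) (hβ : ∀ i, β i ≠ 0) :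
    IsOpen (multisolitonDomain ξ β) := by
  have hc : ContinuousOn (fun p : ℝ × ℝ => multisoliton ξ β p.1 p.2)
      {p : ℝ × ℝ | (solitonMatrix ξ β p.1 p.2).det ≠ 0} := fun p hp =>
    (contDiffAt_multisoliton hξ hβ hp).continuousAt.continuousWithinAt
  exact hc.isOpen_inter_preimage (isOpen_det_solitonMatrix_ne_zero ξ β)
    (isOpen_compl_singleton (x := (0 : ℝ)))

theorem isSolutionOn_multisoliton {α : ℝ} (hα : α ≠ 0) (k : ℤ) (hξ : ∀ i, 0 < ξ i)
    (hβ : ∀ i, β i ≠ 0) :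
    IsSolutionOn α (multisolitonDomain ξ β) (root α k (multisoliton ξ β))
      (logRoot α k (multisoliton ξ β)) := by
  have hx {x t : ℝ} (h : (x, t) ∈ multisolitonDomain ξ β) (i j : ℕ) :=
    hasDerivAt_moment_left hξ (det_symmMatrix_ne_zero hβ h.1) i j
  have ht {x t : ℝ} (h : (x, t) ∈ multisolitonDomain ξ β) (i j : ℕ) :=
    hasDerivAt_moment_right hξ (det_symmMatrix_ne_zero hβ h.1) i j
  let W := moment ξ β
  have hW : ∀ i j x t, moment ξ β i j x t = W i j x t := fun _ _ _ _ => rfl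
  have W10 : ∀ x t, W 1 0 x t = W 0 1 x t := moment_comm ξ β 1 0
  have W20 : ∀ x t, W 2 0 x t = W 0 2 x t := moment_comm ξ β 2 0
  have W30 : ∀ x t, W 3 0 x t = W 0 3 x t := moment_comm ξ β 3 0
  have W21 : ∀ x t, W 2 1 x t = W 1 2 x t := moment_comm ξ β 2 1
  have W31 : ∀ x t, W 3 1 x t = W 1 3 x t := moment_comm ξ β 3 1
  refine IsSolutionOn.of_kdv hα (isOpen_multisolitonDomain hξ hβ)
    -- These come from differentiating `2 (W₀₀² - 2 W₀₁)` by the moment rules, using only the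
    -- symmetry of `W`.
    (u₁ := fun x t => 4 * (W 0 0 x t ^ 3 - 3 * (W 0 0 x t * W 0 1 x t) + W 0 2 x t + W 1 1 x t))
    (u₂ := fun x t => 4 * (3 * W 0 0 x t ^ 4 - 12 * (W 0 0 x t ^ 2 * W 0 1 x t) + 7 * W 0 1 x t ^ 2
      + 4 * (W 0 0 x t * W 0 2 x t) + 3 * (W 0 0 x t * W 1 1 x t) - W 0 3 x t - 3 * W 1 2 x t))
    (u₃ := fun x t => 4 * (12 * W 0 0 x t ^ 3 * (W 0 0 x t ^ 2 - 2 * W 0 1 x t)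
      - 24 * W 0 0 x t * (W 0 0 x t ^ 2 - 2 * W 0 1 x t) * W 0 1 x t
      + (14 * W 0 1 x t - 12 * W 0 0 x t ^ 2) * (W 0 0 x t * W 0 1 x t - W 0 2 x t - W 1 1 x t)
      + (W 0 0 x t ^ 2 - 2 * W 0 1 x t) * (4 * W 0 2 x t + 3 * W 1 1 x t)
      + 4 * W 0 0 x t * (W 0 0 x t * W 0 2 x t - W 0 3 x t - W 1 2 x t)
      + 3 * W 0 0 x t * (W 0 1 x t ^ 2 - 2 * W 1 2 x t)
      - (W 0 0 x t * W 0 3 x t - W 0 4 x t - W 1 3 x t)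
      - 3 * (W 0 1 x t * W 0 2 x t - W 1 3 x t - W 2 2 x t)))
    (ut := fun x t => 16 * (W 0 0 x t * (2 * W 0 3 x t - 2 * (W 0 0 x t * W 0 2 x t) + W 0 1 x t ^ 2)
      - (W 0 4 x t + W 1 3 x t - W 0 1 x t * W 0 2 x t + W 0 1 x t * W 1 1 x t
        - W 0 0 x t * W 1 2 x t)))
    (fun p hp => (contDiffAt_multisoliton hξ hβ hp.1).contDiffWithinAt) (fun x t h => h.2)
    ?_ ?_ ?_ ?_ ?_
  · intro x t h
    have := (((hx h 0 0).fun_pow 2).fun_sub ((hx h 0 1).const_mul 2)).const_mul 2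
    refine (this.congr_of_eventuallyEq ((eventually_det_ne_zero h.1).1.mono fun y hy =>
      multisoliton_eq_moment hξ hβ hy)).congr_deriv ?_
    simp only [hW, zero_add, Nat.reduceAdd, W10]
    ring
  · intro x t h
    have := (((((hx h 0 0).fun_pow 3).fun_sub (((hx h 0 0).fun_mul (hx h 0 1)).const_mul 3)).fun_add
      (hx h 0 2)).fun_add (hx h 1 1)).const_mul 4
    refine this.congr_deriv ?_
    simp only [hW, zero_add, Nat.reduceAdd, W10, W21]
    ring
  · intro x t h
    have := (((((((((hx h 0 0).fun_pow 4).const_mul 3).fun_sub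
      ((((hx h 0 0).fun_pow 2).fun_mul (hx h 0 1)).const_mul 12)).fun_add
      (((hx h 0 1).fun_pow 2).const_mul 7)).fun_add
      (((hx h 0 0).fun_mul (hx h 0 2)).const_mul 4)).fun_add
      (((hx h 0 0).fun_mul (hx h 1 1)).const_mul 3)).fun_sub (hx h 0 3)).fun_sub
      ((hx h 1 2).const_mul 3)).const_mul 4
    refine this.congr_deriv ?_
    simp only [hW, zero_add, Nat.reduceAdd, W10, W21]
    ring
  · intro x t h
    have := (((ht h 0 0).fun_pow 2).fun_sub ((ht h 0 1).const_mul 2)).const_mul 2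
    refine (this.congr_of_eventuallyEq ((eventually_det_ne_zero h.1).2.mono fun y hy =>
      multisoliton_eq_moment hξ hβ hy)).congr_deriv ?_
    simp only [hW, zero_add, Nat.reduceAdd, W10, W20, W30, W21, W31]
    ring
  · intro x t h
    have r1 := moment_add_two hξ (det_symmMatrix_ne_zero hβ h.1) 0 1
    have r2 := moment_add_two hξ (det_symmMatrix_ne_zero hβ h.1) 0 2
    rw [multisoliton_eq_moment hξ hβ h.1]
    simp only [hW, zero_add, Nat.reduceAdd, W21] at r1 r2 ⊢
    -- The coefficients are forced by the terms `12 W₀₀ W₀₃` and `-12 W₀₄` left in the KdV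
    -- expression.
    linear_combination 12 * W 0 0 x t * r1 - 12 * r2

end Multisoliton

/-! ### The explicit one- and two-soliton -/

theorem iteratedDeriv_two_log {f f₁ f₂ : ℝ → ℝ} (c p q : ℝ) (hc : c ≠ 0) (hf : ∀ y, 0 < f y)
    (h₁ : ∀ y, HasDerivAt f (f₁ y) y) (h₂ : ∀ y, HasDerivAt f₁ (f₂ y) y) (x : ℝ) :
    iteratedDeriv 2 (fun y => Real.log (c * Real.exp (p * y + q) * f y)) x =
      (f₂ x * f x - f₁ x ^ 2) / f x ^ 2 := by
  have e : (fun y => Real.log (c * Real.exp (p * y + q) * f y)) =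
      fun y => Real.log c + (p * y + q) + Real.log (f y) := by
    ext y
    rw [Real.log_mul (mul_ne_zero hc (Real.exp_ne_zero _)) (hf y).ne',
      Real.log_mul hc (Real.exp_ne_zero _), Real.log_exp]
  rw [e]
  refine iteratedDeriv_two_of_hasDerivAt (f₁ := fun y => p + f₁ y / f y)
    (Filter.Eventually.of_forall fun y => ?_) ?_
  · have hl : HasDerivAt (fun y : ℝ => Real.log c + (p * y + q)) p y := by
      simpa using (((hasDerivAt_id y).const_mul p).add_const q).const_add (Real.log c)
    exact hl.add ((h₁ y).log (hf y).ne')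
  · refine (((h₂ x).fun_div (h₁ x) (hf x).ne').const_add p).congr_deriv ?_
    ring

theorem hasDerivAt_cosh_affine (p q x : ℝ) :
    HasDerivAt (fun y => Real.cosh (p * y + q)) (p * Real.sinh (p * x + q)) x := by
  have := (((hasDerivAt_id x).const_mul p).add_const q).cosh
  simpa [mul_comm] using this

theorem hasDerivAt_sinh_affine (p q x : ℝ) :
    HasDerivAt (fun y => Real.sinh (p * y + q)) (p * Real.cosh (p * x + q)) x := by
  have := (((hasDerivAt_id x).const_mul p).add_const q).sinh
  simpa [mul_comm] using this

/-- The velocity is `4 ξ² = c`, so `ξ = √c / 2`; taking `β = 2 ξ` makes the determinant `1 +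
e^(-2θ)` with `θ = ξ (x - c t)`, which is `2 e^(-θ) cosh θ`. -/
theorem det_solitonMatrix_one {c : ℝ} (hc : 0 < c) (x t : ℝ) :
    (solitonMatrix ![Real.sqrt c / 2] ![Real.sqrt c] x t).det =
      2 * Real.exp (-(Real.sqrt c / 2) * x + Real.sqrt c / 2 * c * t) *
        Real.cosh (Real.sqrt c / 2 * x + -(Real.sqrt c / 2 * c * t)) := by
  have hs : Real.sqrt c ≠ 0 := (Real.sqrt_pos.2 hc).ne'
  have h2 : Real.sqrt c ^ 2 = c := Real.sq_sqrt hc.le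
  rw [Matrix.det_fin_one]
  simp only [solitonMatrix, Matrix.of_apply, if_true, Matrix.cons_val_fin_one, add_halves]
  rw [mul_assoc (Real.sqrt c), mul_div_cancel_left₀ _ hs, ← Real.exp_add, Real.cosh_eq]
  have e : 2 * Real.exp (-(Real.sqrt c / 2) * x + Real.sqrt c / 2 * c * t) *
      ((Real.exp (Real.sqrt c / 2 * x + -(Real.sqrt c / 2 * c * t)) +
        Real.exp (-(Real.sqrt c / 2 * x + -(Real.sqrt c / 2 * c * t)))) / 2) =
      Real.exp (-(Real.sqrt c / 2) * x + Real.sqrt c / 2 * c * t) *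
        Real.exp (Real.sqrt c / 2 * x + -(Real.sqrt c / 2 * c * t)) +
      Real.exp (-(Real.sqrt c / 2) * x + Real.sqrt c / 2 * c * t) *
        Real.exp (-(Real.sqrt c / 2 * x + -(Real.sqrt c / 2 * c * t))) := by
    ring
  rw [e, ← Real.exp_add, ← Real.exp_add]
  congr 1
  · rw [eq_comm, Real.exp_eq_one_iff]
    ring
  · congr 1
    linear_combination Real.sqrt c * t * h2

theorem multisoliton_eq_soliton {c : ℝ} (hc : 0 < c) :
    multisoliton ![Real.sqrt c / 2] ![Real.sqrt c] = soliton c := by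
  funext x t
  have h2 : Real.sqrt c ^ 2 = c := Real.sq_sqrt hc.le
  simp only [multisoliton, det_solitonMatrix_one hc]
  rw [iteratedDeriv_two_log _ _ _ two_ne_zero (fun y => Real.cosh_pos _)
    (fun y => hasDerivAt_cosh_affine _ _ y)
    (fun y => (hasDerivAt_sinh_affine _ _ y).const_mul (Real.sqrt c / 2)), soliton]
  have e : Real.sqrt c / 2 * (x - c * t) = Real.sqrt c / 2 * x + -(Real.sqrt c / 2 * c * t) := by
    ring
  rw [e]
  have hC := (Real.cosh_pos (Real.sqrt c / 2 * x + -(Real.sqrt c / 2 * c * t))).ne'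
  have hS := Real.cosh_sq (Real.sqrt c / 2 * x + -(Real.sqrt c / 2 * c * t))
  set C := Real.cosh (Real.sqrt c / 2 * x + -(Real.sqrt c / 2 * c * t))
  set S := Real.sinh (Real.sqrt c / 2 * x + -(Real.sqrt c / 2 * c * t))
  field_simp
  linear_combination (-Real.sqrt c ^ 2) * hS - h2

theorem multisolitonDomain_one {c : ℝ} (hc : 0 < c) :
    multisolitonDomain ![Real.sqrt c / 2] ![Real.sqrt c] = Set.univ := by
  refine Set.eq_univ_of_forall fun p => ⟨?_, ?_⟩
  · rw [det_solitonMatrix_one hc]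
    have := Real.cosh_pos (Real.sqrt c / 2 * p.1 + -(Real.sqrt c / 2 * c * p.2))
    positivity
  · rw [multisoliton_eq_soliton hc, soliton]
    have := Real.cosh_pos (Real.sqrt c / 2 * (p.1 - c * p.2))
    exact mul_ne_zero (by linarith) (by positivity)

/-- With `a = e^(64t - 4x)` and `b = e^(8t - 2x)`, the determinant is `1 + 3a + 3b + ab`. Its
symmetric coefficients allow `√(ab)` to be factored out, leaving hyperbolic cosines. -/
theorem det_solitonMatrix_two (x t : ℝ) :
    (solitonMatrix ![2, 1] ![12, 6] x t).det =
      2 * Real.exp (-3 * x + 36 * t) *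
        (Real.cosh (-3 * x + 36 * t) + 3 * Real.cosh (-1 * x + 28 * t)) := by
  rw [Matrix.det_fin_two]
  simp only [solitonMatrix, Matrix.of_apply, Matrix.cons_val_zero, Matrix.cons_val_one,
    if_true, Fin.zero_eq_one_iff, Fin.one_eq_zero_iff, OfNat.ofNat_ne_one, if_false]
  -- Writing every exponential through `e^(-x)` and `e^t` reduces the claim to a rational identity.
  have e1 : Real.exp (8 * 2 ^ 3 * t) = Real.exp t ^ 64 := by
    rw [← Real.exp_nat_mul]; norm_num
  have e2 : Real.exp (8 * 1 ^ 3 * t) = Real.exp t ^ 8 := by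
    rw [← Real.exp_nat_mul]; norm_num
  have e3 : Real.exp (-(2 + 2) * x) = Real.exp (-x) ^ 4 := by
    rw [← Real.exp_nat_mul]; congr 1; push_cast; ring
  have e4 : Real.exp (-(2 + 1) * x) = Real.exp (-x) ^ 3 := by
    rw [← Real.exp_nat_mul]; congr 1; push_cast; ring
  have e5 : Real.exp (-(1 + 2) * x) = Real.exp (-x) ^ 3 := by
    rw [← Real.exp_nat_mul]; congr 1; push_cast; ring
  have e6 : Real.exp (-(1 + 1) * x) = Real.exp (-x) ^ 2 := by
    rw [← Real.exp_nat_mul]; congr 1; push_cast; ring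
  have e7 : Real.exp (-3 * x + 36 * t) = Real.exp (-x) ^ 3 * Real.exp t ^ 36 := by
    rw [← Real.exp_nat_mul, ← Real.exp_nat_mul, ← Real.exp_add]; congr 1; push_cast; ring
  have e8 : Real.exp (-1 * x + 28 * t) = Real.exp (-x) * Real.exp t ^ 28 := by
    rw [← Real.exp_nat_mul, ← Real.exp_add]; congr 1; push_cast; ring
  rw [Real.cosh_eq, Real.cosh_eq, Real.exp_neg (-3 * x + 36 * t), Real.exp_neg (-1 * x + 28 * t),
    e1, e2, e3, e4, e5, e6, e7, e8]
  have hX := Real.exp_pos (-x)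
  have hT := Real.exp_pos t
  field_simp
  ring

theorem multisoliton_eq_bisoliton : multisoliton ![2, 1] ![12, 6] = bisoliton := by
  funext x t
  simp only [multisoliton, det_solitonMatrix_two]
  rw [iteratedDeriv_two_log _ _ _ two_ne_zero
    (fun y => add_pos (Real.cosh_pos _) (mul_pos three_pos (Real.cosh_pos _)))
    (fun y => (hasDerivAt_cosh_affine _ _ y).fun_add ((hasDerivAt_cosh_affine _ _ y).const_mul 3))
    (fun y => ((hasDerivAt_sinh_affine _ _ y).const_mul (-3)).fun_add
      (((hasDerivAt_sinh_affine _ _ y).const_mul (-1)).const_mul 3)), bisoliton]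
  have a1 : 36 * t - 3 * x = -3 * x + 36 * t := by ring
  have a2 : 28 * t - x = -1 * x + 28 * t := by ring
  -- The arguments in the numerator are the difference and the sum of those in the denominator.
  have a3 : 8 * t - 2 * x = (-3 * x + 36 * t) - (-1 * x + 28 * t) := by ring
  have a4 : 64 * t - 4 * x = (-3 * x + 36 * t) + (-1 * x + 28 * t) := by ring
  rw [a1, a2, a3, a4, Real.cosh_sub (-3 * x + 36 * t),
    Real.cosh_add (-3 * x + 36 * t) (-1 * x + 28 * t)]
  have h1 := Real.cosh_sq (-3 * x + 36 * t)
  have h2 := Real.cosh_sq (-1 * x + 28 * t)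
  rw [mul_div_assoc', mul_div_assoc']
  congr 1
  linear_combination (-18) * h1 - 18 * h2

theorem multisolitonDomain_two : multisolitonDomain ![2, 1] ![12, 6] = Set.univ := by
  refine Set.eq_univ_of_forall fun p => ⟨?_, ?_⟩
  · rw [det_solitonMatrix_two]
    have h1 := Real.cosh_pos (-3 * p.1 + 36 * p.2)
    have h2 := Real.cosh_pos (-1 * p.1 + 28 * p.2)
    positivity
  · rw [multisoliton_eq_bisoliton, bisoliton]
    have h1 := Real.cosh_pos (36 * p.2 - 3 * p.1)
    have h2 := Real.cosh_pos (28 * p.2 - p.1)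
    have h3 := Real.cosh_pos (8 * p.2 - 2 * p.1)
    have h4 := Real.cosh_pos (64 * p.2 - 4 * p.1)
    exact mul_ne_zero (by norm_num) (by positivity)

end KdVPower

theorem proposition25 (α : ℝ) (hα : α ≠ 0) (k : ℤ) :
    (∀ c : ℝ, 0 < c →
      KdVPower.IsSolutionOn α Set.univ
        (KdVPower.root α k (KdVPower.soliton c))
        (KdVPower.logRoot α k (KdVPower.soliton c))) ∧
    (∀ (N : ℕ) (ξ β : Fin N → ℝ), Antitone ξ → (∀ i, 0 < ξ i) → (∀ i, β i ≠ 0) →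
      KdVPower.IsSolutionOn α (KdVPower.multisolitonDomain ξ β)
        (KdVPower.root α k (KdVPower.multisoliton ξ β))
        (KdVPower.logRoot α k (KdVPower.multisoliton ξ β))) ∧
    KdVPower.IsSolutionOn α Set.univ
      (KdVPower.root α k KdVPower.bisoliton)
      (KdVPower.logRoot α k KdVPower.bisoliton) := by
  refine ⟨fun c hc => ?_, fun N ξ β _ hξ hβ => KdVPower.isSolutionOn_multisoliton hα k hξ hβ, ?_⟩
  · have hs := Real.sqrt_pos.2 hc
    have := KdVPower.isSolutionOn_multisoliton hα k (ξ := ![Real.sqrt c / 2]) (β := ![Real.sqrt c])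
      (by simpa [Fin.forall_fin_one] using hc) (by simpa [Fin.forall_fin_one] using hs.ne')
    rwa [KdVPower.multisoliton_eq_soliton hc, KdVPower.multisolitonDomain_one hc] at this
  · have := KdVPower.isSolutionOn_multisoliton hα k (ξ := ![2, 1]) (β := ![12, 6])
      (by simp [Fin.forall_fin_two]) (by simp [Fin.forall_fin_two])
    rwa [KdVPower.multisoliton_eq_bisoliton, KdVPower.multisolitonDomain_two] at this
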